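/- Let $K$ be a number of arms. There are functions $C_1,\dots,C_K:[0,1]^K\to\mathbb R$ (depending only on $K$) such that the following holds. Suppose that each arm $b\in\{1,\dots,K\}$ of a context-free Bernoulli bandit has $n_b\ge 2$ observed binary rewards with proportion of successes $p_b\in(0,1)$ (so $n_bp_b$ is an integer). Given these data, Thompson sampling draws independent values $\theta_b\sim\mathrm{Beta}(n_bp_b,\,n_b(1-p_b))$, $b=1,\dots,K$, and chooses an arm $a^{TS}$ with the largest value; the bootstrap draws independent values $\theta'_b\sim\frac1{n_b}\mathrm{Binomial}(n_b,p_b)$, $b=1,\dots,K$ (the proportion of successes in a dataset obtained by resampling the $n_b$ rewards of arm $b$ with replacement), and chooses an arm $a^{B}$ with the largest value. Ties are broken in an arbitrary, possibly random, way. Then, for every arm $a\in\{1,\dots,K\}$, $$\bigl|P(a^{TS}=a)-P(a^{B}=a)\bigr|\;\le\; C_a(p_1,\dots,p_K)\sum_{b=1}^K\frac1{\sqrt{n_b}} .$$ In particular $C_a(p_1,\dots,p_K)$ does not depend on $n_1,\dots,n_K$ or on the tie-breaking rule. -/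

import Mathlib

open MeasureTheory ProbabilityTheory

/-- The Thompson sampling draw for an arm with `n` observations and proportion of successes `p`:
the Beta distribution with parameters `n * p` and `n * (1 - p)`. -/
noncomputable def thompsonLaw (n : ℕ) (p : unitInterval) : Measure ℝ :=
  betaMeasure ((n : ℝ) * (p : ℝ)) ((n : ℝ) * (1 - (p : ℝ)))

/-- The bootstrap draw for an arm with `n` observations and proportion of successes `p`:
the distribution of a Binomial(`n`, `p`) random variable divided by `n`, i.e. of the proportion of
successes in a dataset resampled with replacement. -/
noncomputable def bootstrapLaw (n : ℕ) (p : unitInterval) : Measure ℝ :=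
  (binomial n p).map (fun k : ℕ => (k : ℝ) / (n : ℝ))

/-- The random action `A` is produced by drawing, independently over the arms, a value `θ b` from
`law b` for each arm `b`, and then choosing an arm whose value is the largest. The way in which
ties are broken is arbitrary (it may be random, and may depend on the draws). -/
structure IsArgmaxAction {K : ℕ} {Ω : Type*} [MeasurableSpace Ω] (P : Measure Ω)
    (law : Fin K → Measure ℝ) (A : Ω → Fin K) : Prop where
  measurable : Measurable A
  exists_draws : ∃ θ : Fin K → Ω → ℝ,
    (∀ b, HasLaw (θ b) (law b) P) ∧ iIndepFun θ P ∧ ∀ᵐ ω ∂P, ∀ b, θ b ω ≤ θ (A ω) ω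

/-! For one arm, the beta and the rescaled binomial law have the same mean p and fluctuations of
order 1/√n. Their distribution functions differ by at most `armConstant p / √n`
(`abs_thompsonLaw_real_Iic_sub_le`). This is proved by comparing Stein operators directly, without a
normal approximation in between.

The binomial operator is p(n-k)g(k+1) - (1-p)k g(k); the beta operator is x(1-x)f' + n(p-x)f.
`exists_binomial_stein_solution` solves the binomial equation for the indicator of k ≤ m with
increments O(1/n), and `abs_le_of_stein_equation` deduces g = O(1/√n). Let f be the piecewise affine
function with f(k/n) = g(k). The beta operator applied to f has integral zero under the beta law,
and it differs from the binomial operator applied to g by an error whose beta mean is O(1/√n). This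
compares the distribution functions on the grid (`abs_integral_betaWeight_sub_le`); between grid
points, the beta mass of one cell is O(1/√n) (`integral_cell_betaWeight_le`).

For several arms, the event that arm a is best has only half-lines as sections, so exchanging the
factors of the product law one at a time costs the sum of the Kolmogorov distances
(`abs_pi_real_sub_le`). Tie-breaking is handled by a sandwich between "only best arm" and "one of
the best arms" (`IsArgmaxAction.bounds`); these have equal probability for the atomless beta laws.
-/

/-- The weights of the binomial distribution. -/
noncomputable def binomialWeight (n : ℕ) (p : ℝ) (k : ℕ) : ℝ :=
  (n.choose k : ℝ) * p ^ k * (1 - p) ^ (n - k)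

/-! ### Binomial weights: truncated moments and tail bounds. -/

section BinomialWeight

variable {n : ℕ} {p : ℝ}

lemma binomialWeight_pos (hp : 0 < p) (hp1 : p < 1) {k : ℕ} (hk : k ≤ n) :
    0 < binomialWeight n p k := by
  have h1 : 0 < n.choose k := Nat.choose_pos hk
  have h2 : 0 < 1 - p := by linarith
  unfold binomialWeight
  positivity

lemma binomialWeight_nonneg (hp : 0 < p) (hp1 : p < 1) (k : ℕ) : 0 ≤ binomialWeight n p k := by
  have h2 : 0 < 1 - p := by linarith
  unfold binomialWeight
  positivity

lemma sum_binomialWeight : ∑ k ∈ Finset.range (n + 1), binomialWeight n p k = 1 := by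
  have h := add_pow p (1 - p) n
  rw [add_sub_cancel, one_pow] at h
  rw [h]
  refine Finset.sum_congr rfl fun k _ => ?_
  unfold binomialWeight
  ring

/-- Detailed balance for the binomial distribution. -/
lemma binomialWeight_succ {k : ℕ} (hk : k < n) :
    p * (n - k) * binomialWeight n p k
      = (1 - p) * ((k + 1 : ℕ) : ℝ) * binomialWeight n p (k + 1) := by
  have h : ((n.choose (k + 1) : ℝ)) * ((k + 1 : ℕ) : ℝ) = (n.choose k : ℝ) * ((n : ℝ) - k) := by
    have := Nat.choose_succ_right_eq n k
    rw [← Nat.cast_sub hk.le]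
    exact_mod_cast this
  obtain ⟨r, rfl⟩ : ∃ r, n = k + 1 + r := ⟨n - (k + 1), by omega⟩
  unfold binomialWeight
  rw [show k + 1 + r - k = r + 1 by omega, show k + 1 + r - (k + 1) = r by omega]
  linear_combination (-p ^ (k + 1) * (1 - p) ^ (r + 1)) * h

/-- The truncated first moment below `k`. -/
lemma sum_range_sub_mul_binomialWeight {k : ℕ} (hk : k ≤ n) :
    ∑ j ∈ Finset.range k, (n * p - j) * binomialWeight n p j
      = (1 - p) * k * binomialWeight n p k := by
  induction k with
  | zero => simp
  | succ k ih =>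
    rw [Finset.sum_range_succ, ih (by omega), ← binomialWeight_succ (by omega)]
    ring

/-- The truncated first moment above `k`. -/
lemma sum_Ico_sub_mul_binomialWeight {k : ℕ} (hk : k ≤ n) :
    ∑ j ∈ Finset.Ico (k + 1) (n + 1), (j - n * p) * binomialWeight n p j
      = p * (n - k) * binomialWeight n p k := by
  have h1 := Finset.sum_range_add_sum_Ico (fun j : ℕ => (n * p - j) * binomialWeight n p j)
    (show k + 1 ≤ n + 1 by omega)
  rw [Finset.sum_range_succ, sum_range_sub_mul_binomialWeight hk, Finset.sum_range_succ,
    sum_range_sub_mul_binomialWeight le_rfl] at h1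
  have h2 : ∑ j ∈ Finset.Ico (k + 1) (n + 1), (j - n * p) * binomialWeight n p j
      = - ∑ j ∈ Finset.Ico (k + 1) (n + 1), (n * p - j) * binomialWeight n p j := by
    rw [← Finset.sum_neg_distrib]
    exact Finset.sum_congr rfl fun j _ => by ring
  rw [h2]
  linarith

/-- For j < k one has np - k ≤ np - j, so the tail is controlled by the truncated first moment,
which has a closed form. The bound is informative when k lies below the mean. -/
lemma sum_range_binomialWeight_mul_le (hp : 0 < p) (hp1 : p < 1) {k : ℕ} (hk : k ≤ n) :
    (∑ j ∈ Finset.range k, binomialWeight n p j) * (n * p - k)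
      ≤ (1 - p) * k * binomialWeight n p k := by
  rw [← sum_range_sub_mul_binomialWeight hk, Finset.sum_mul]
  refine Finset.sum_le_sum fun j hj => ?_
  have h1 : (j : ℝ) ≤ k := by exact_mod_cast (Finset.mem_range.1 hj).le
  nlinarith [binomialWeight_nonneg (n := n) hp hp1 j]

lemma sum_Ico_binomialWeight_mul_le (hp : 0 < p) (hp1 : p < 1) {k : ℕ} (hk : k ≤ n) :
    (∑ j ∈ Finset.Ico (k + 1) (n + 1), binomialWeight n p j) * (k - n * p)
      ≤ p * (n - k) * binomialWeight n p k := by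
  rw [← sum_Ico_sub_mul_binomialWeight hk, Finset.sum_mul]
  refine Finset.sum_le_sum fun j hj => ?_
  have h1 : (k : ℝ) ≤ j := by exact_mod_cast (by have := (Finset.mem_Ico.1 hj).1; omega)
  nlinarith [binomialWeight_nonneg (n := n) hp hp1 j]

lemma sum_le_one_of_subset (hp : 0 < p) (hp1 : p < 1) {t : Finset ℕ}
    (ht : t ⊆ Finset.range (n + 1)) : ∑ j ∈ t, binomialWeight n p j ≤ 1 := by
  rw [← sum_binomialWeight (n := n) (p := p)]
  exact Finset.sum_le_sum_of_subset_of_nonneg ht fun j _ _ => binomialWeight_nonneg hp hp1 j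

/-- Detailed balance gives p(n-k)b(j) ≤ p(n-j)b(j) = (1-p)(j+1)b(j+1) ≤ (1-p)k b(j+1) for j < k, and
the shifted weights sum to at most 1. Unlike the previous bounds, no weight remains on the right. -/
lemma sum_range_binomialWeight_mul_le' (hp : 0 < p) (hp1 : p < 1) {k : ℕ} (hk : k ≤ n) :
    (∑ j ∈ Finset.range k, binomialWeight n p j) * (p * (n - k)) ≤ (1 - p) * k := by
  calc (∑ j ∈ Finset.range k, binomialWeight n p j) * (p * (n - k))
      ≤ ∑ j ∈ Finset.range k, (1 - p) * k * binomialWeight n p (j + 1) := by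
        rw [Finset.sum_mul]
        refine Finset.sum_le_sum fun j hj => ?_
        have hj' := Finset.mem_range.1 hj
        have h1 : ((j + 1 : ℕ) : ℝ) ≤ k := by exact_mod_cast hj'
        have h2 : (j : ℝ) ≤ k := by exact_mod_cast hj'.le
        have h3 := binomialWeight_succ (p := p) (show j < n by omega)
        have h4 := binomialWeight_nonneg (n := n) hp hp1 j
        have h5 := binomialWeight_nonneg (n := n) hp hp1 (j + 1)
        have h6 : 0 ≤ (1 - p) * binomialWeight n p (j + 1) := mul_nonneg (by linarith) h5
        have h7 : 0 ≤ p * binomialWeight n p j := mul_nonneg hp.le h4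
        nlinarith
    _ ≤ (1 - p) * k * 1 := by
        rw [← Finset.mul_sum]
        refine mul_le_mul_of_nonneg_left ?_ (mul_nonneg (by linarith) (Nat.cast_nonneg k))
        have h := Finset.sum_range_succ' (fun j => binomialWeight n p j) k
        have := sum_le_one_of_subset (n := n) hp hp1 (t := Finset.range (k + 1))
          (Finset.range_subset_range.2 (by omega))
        linarith [binomialWeight_nonneg (n := n) hp hp1 0]
    _ = (1 - p) * k := mul_one _

lemma sum_Ico_binomialWeight_mul_le' (hp : 0 < p) (hp1 : p < 1) {k : ℕ} (hk : k ≤ n) :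
    (∑ j ∈ Finset.Ico (k + 1) (n + 1), binomialWeight n p j) * ((1 - p) * k) ≤ p * (n - k) := by
  have hkn : (k : ℝ) ≤ n := by exact_mod_cast hk
  calc (∑ j ∈ Finset.Ico (k + 1) (n + 1), binomialWeight n p j) * ((1 - p) * k)
      = ∑ j ∈ Finset.Ico k n, binomialWeight n p (j + 1) * ((1 - p) * k) := by
        rw [← Finset.sum_Ico_add' (fun j => binomialWeight n p j) k n 1, Finset.sum_mul]
    _ ≤ ∑ j ∈ Finset.Ico k n, p * (n - k) * binomialWeight n p j := by
        refine Finset.sum_le_sum fun j hj => ?_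
        have hj' := Finset.mem_Ico.1 hj
        have h2 : (k : ℝ) ≤ j := by exact_mod_cast hj'.1
        have h3 := binomialWeight_succ (p := p) hj'.2
        push_cast at h3
        have h4 := binomialWeight_nonneg (n := n) hp hp1 j
        have h5 := binomialWeight_nonneg (n := n) hp hp1 (j + 1)
        have h6 : 0 ≤ (1 - p) * binomialWeight n p (j + 1) := mul_nonneg (by linarith) h5
        have h7 : 0 ≤ p * binomialWeight n p j := mul_nonneg hp.le h4
        nlinarith
    _ ≤ p * (n - k) * 1 := by
        rw [← Finset.mul_sum]
        refine mul_le_mul_of_nonneg_left ?_ (mul_nonneg hp.le (by linarith))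
        refine sum_le_one_of_subset hp hp1 fun j hj => ?_
        have hj' := Finset.mem_Ico.1 hj
        exact Finset.mem_range.2 (by omega)
    _ = p * (n - k) := mul_one _

end BinomialWeight

/-! ### Stein equation of the binomial distribution. -/

/-- The estimate behind the bound on the increments of the Stein solution. -/
lemma abs_mul_div_sub_div_le {a c β L R t d : ℝ} (ha : 0 < a) (hc : 0 < c) (hβ : 0 < β)
    (ht : 0 ≤ t) (htR : t ≤ R) (hL : 0 ≤ L) (hL1 : L ≤ 1) (hR1 : R ≤ 1)
    (h1 : L * (c - a) ≤ a * β) (h2 : R * (a - c) ≤ c * β) (h3 : R * a ≤ c)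
    (hd : 0 < d) (hd' : d ≤ a ∨ d ≤ c) :
    |t * ((L + β) / (c * β) - L / (a * β))| ≤ 2 / d := by
  have e : t * ((L + β) / (c * β) - L / (a * β))
      = t * (a * β - L * (c - a)) / (a * c * β) := by
    field_simp
    ring
  have hpos : 0 ≤ t * (a * β - L * (c - a)) := mul_nonneg ht (by linarith)
  have hP : 0 < a * c * β := by positivity
  rw [e, abs_of_nonneg (div_nonneg hpos hP.le), div_le_div_iff₀ hP hd]
  have k1 : t * a ≤ c := le_trans (mul_le_mul_of_nonneg_right htR ha.le) h3
  have k2 : t * a ≤ a := by nlinarith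
  -- As d ≤ max(a, c), it is enough to bound the numerator times this maximum M by 2acβ. If M = a,
  -- the terms taβ and tL(a-c) are each at most cβ, by `h3` and `h2`; if M = c, the L-term has a
  -- favourable sign.
  have key : ∀ M, d ≤ M → (M = a ∧ c ≤ a ∨ M = c ∧ a ≤ c) →
      t * (a * β - L * (c - a)) * d ≤ 2 * (a * c * β) := by
    rintro M hdM (⟨rfl, hca⟩ | ⟨rfl, hac⟩)
    · have q1 : t * M * β ≤ c * β := mul_le_mul_of_nonneg_right k1 hβ.le
      have q2 : t * (L * (M - c)) ≤ c * β := by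
        have : t * (M - c) ≤ c * β :=
          le_trans (mul_le_mul_of_nonneg_right htR (by linarith)) h2
        have h0 : 0 ≤ t * (M - c) := mul_nonneg ht (by linarith)
        nlinarith
      calc t * (M * β - L * (c - M)) * d ≤ t * (M * β - L * (c - M)) * M :=
            mul_le_mul_of_nonneg_left hdM hpos
        _ ≤ (2 * (c * β)) * M := mul_le_mul_of_nonneg_right (by nlinarith) ha.le
        _ = 2 * (M * c * β) := by ring
    · have q1 : t * a * β ≤ a * β := mul_le_mul_of_nonneg_right k2 hβ.le
      have q2 : 0 ≤ t * (L * (M - a)) :=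
        mul_nonneg ht (mul_nonneg hL (by linarith))
      calc t * (a * β - L * (M - a)) * d ≤ t * (a * β - L * (M - a)) * M :=
            mul_le_mul_of_nonneg_left hdM hpos
        _ ≤ (a * β) * M := mul_le_mul_of_nonneg_right (by nlinarith) hc.le
        _ ≤ 2 * (a * M * β) := by nlinarith
  rcases le_total c a with h | h
  · exact key a (hd'.elim id fun h' => h'.trans h) (Or.inl ⟨rfl, h⟩)
  · exact key c (hd'.elim (fun h' => h'.trans h) id) (Or.inr ⟨rfl, h⟩)

/-- The Stein equation of the binomial distribution for a half-line has a solution with increments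
of order `1 / n`. -/
theorem exists_binomial_stein_solution {n : ℕ} {p : ℝ} (hp : 0 < p) (hp1 : p < 1) {m : ℕ}
    (hm : m < n) :
    ∃ g : ℕ → ℝ, g 0 = 0 ∧
      (∀ k < n, p * (n - k) * g (k + 1) - (1 - p) * k * g k
        = (if k ≤ m then 1 else 0) - ∑ j ∈ Finset.range (m + 1), binomialWeight n p j) ∧
      ∀ k < n, |g (k + 1) - g k| ≤ 2 / (n * (p * (1 - p))) := by
  have hq : 0 < 1 - p := by linarith
  have hn : (0 : ℝ) < n := by exact_mod_cast (by omega : 0 < n)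
  have hd : 0 < (n : ℝ) * (p * (1 - p)) := by positivity
  set b := binomialWeight n p with hb
  set F := ∑ j ∈ Finset.range (m + 1), b j with hF
  -- Multiplying the Stein equation by b(k) and using detailed balance makes its left side
  -- telescope, so these partial sums determine g.
  set N : ℕ → ℝ := fun k => ∑ j ∈ Finset.range k, b j * ((if j ≤ m then 1 else 0) - F) with hN
  have hN1 : ∀ k ≤ m + 1, N k = (∑ j ∈ Finset.range k, b j) * (1 - F) := by
    intro k hk
    rw [hN, Finset.sum_mul]
    refine Finset.sum_congr rfl fun j hj => ?_
    rw [if_pos (by have := Finset.mem_range.1 hj; omega)]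
  have hN2 : ∀ k, m + 1 ≤ k → N k = F * (1 - ∑ j ∈ Finset.range k, b j) := by
    intro k hk
    induction k, hk using Nat.le_induction with
    | base => rw [hN1 _ le_rfl, ← hF]
    | succ k hk ih =>
      have : N (k + 1) = N k + b k * ((if k ≤ m then 1 else 0) - F) := Finset.sum_range_succ _ _
      rw [this, ih, if_neg (by omega), Finset.sum_range_succ]
      ring
  have hbpos : ∀ k ≤ n, 0 < b k := fun k hk => binomialWeight_pos hp hp1 hk
  have hsplit : ∀ k ≤ n, (∑ j ∈ Finset.range k, b j) + b k
      + ∑ j ∈ Finset.Ico (k + 1) (n + 1), b j = 1 := by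
    intro k hk
    rw [← Finset.sum_range_succ, Finset.sum_range_add_sum_Ico _ (by omega), hb,
      sum_binomialWeight]
  -- At k = 0 the denominator is zero, and division by zero gives the required value g 0 = 0.
  set g : ℕ → ℝ := fun k => N k / ((1 - p) * k * b k) with hg
  have hgs : ∀ k < n, g (k + 1) = N (k + 1) / (p * (n - k) * b k) := by
    intro k hk
    rw [hg, hb, binomialWeight_succ hk]
  refine ⟨g, by simp [hg], ?_, ?_⟩
  · intro k hk
    have hkn : (0 : ℝ) < n - k := by
      have : (k : ℝ) < n := by exact_mod_cast hk
      linarith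
    have hbk := hbpos k hk.le
    have e1 : p * (n - k) * g (k + 1) = N (k + 1) / b k := by
      rw [hgs k hk]; field_simp
    have e2 : (1 - p) * k * g k = N k / b k := by
      rcases Nat.eq_zero_or_pos k with rfl | hk0
      · simp [hN]
      · have : (0 : ℝ) < k := by exact_mod_cast hk0
        simp only [hg]; field_simp
    have e3 : N (k + 1) = N k + b k * ((if k ≤ m then 1 else 0) - F) := Finset.sum_range_succ _ _
    rw [e1, e2, e3]
    field_simp
    ring
  · intro k hk
    have hkn : (0 : ℝ) < n - k := by
      have : (k : ℝ) < n := by exact_mod_cast hk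
      linarith
    have hbk := hbpos k hk.le
    have hbn : ∀ j, 0 ≤ b j := fun j => binomialWeight_nonneg hp hp1 j
    set L := ∑ j ∈ Finset.range k, b j with hL
    set R := ∑ j ∈ Finset.Ico (k + 1) (n + 1), b j with hR
    have hLR : L + b k + R = 1 := hsplit k hk.le
    have hL0 : 0 ≤ L := Finset.sum_nonneg fun j _ => hbn j
    have hR0 : 0 ≤ R := Finset.sum_nonneg fun j _ => hbn j
    have hF0 : 0 ≤ F := Finset.sum_nonneg fun j _ => hbn j
    have hF1 : F ≤ 1 := sum_le_one_of_subset hp hp1 (Finset.range_subset_range.2 (by omega))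
    have hLs : ∑ j ∈ Finset.range (k + 1), b j = L + b k := Finset.sum_range_succ _ _
    rcases Nat.eq_zero_or_pos k with rfl | hk0
    -- Here the downward rate (1-p)k vanishes, so the general estimate does not apply and g 1 is
    -- computed directly.
    · have hL' : L = 0 := by simp [hL]
      have hg0 : g 0 = 0 := by simp [hg]
      rw [hgs 0 hk, hN1 _ (by omega), hLs, hL', hg0, zero_add, sub_zero]
      have e : b 0 * (1 - F) / (p * (n - ((0 : ℕ) : ℝ)) * b 0) = (1 - F) / (n * p) := by
        simp only [Nat.cast_zero, sub_zero]
        field_simp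
      rw [e, abs_of_nonneg (div_nonneg (by linarith) (by positivity)),
        div_le_div_iff₀ (by positivity) hd]
      have : (1 - F) * (1 - p) ≤ 2 := by nlinarith
      have h3 : 0 < n * p := by positivity
      nlinarith
    · have hk' : (0 : ℝ) < k := by exact_mod_cast hk0
      have ha : 0 < (1 - p) * (k : ℝ) := by positivity
      have hc : 0 < p * ((n : ℝ) - k) := by positivity
      have l1 : L * (n * p - k) ≤ (1 - p) * k * b k :=
        sum_range_binomialWeight_mul_le hp hp1 hk.le
      have l2 : R * (k - n * p) ≤ p * (n - k) * b k := sum_Ico_binomialWeight_mul_le hp hp1 hk.le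
      have l3 : R * ((1 - p) * k) ≤ p * (n - k) := sum_Ico_binomialWeight_mul_le' hp hp1 hk.le
      have l4 : L * (p * (n - k)) ≤ (1 - p) * k := sum_range_binomialWeight_mul_le' hp hp1 hk.le
      -- The quantity np(1-p) is a convex combination of the two rates, hence at most one of them.
      have ed : p * ((1 - p) * k) + (1 - p) * (p * (n - k)) = n * (p * (1 - p)) := by ring
      have hdd : (n : ℝ) * (p * (1 - p)) ≤ (1 - p) * k ∨ n * (p * (1 - p)) ≤ p * (n - k) := by
        by_contra! h
        nlinarith [h.1, h.2]
      -- The two cases mirror each other: for k > m the tails L and R, and the two rates, exchange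
      -- roles, and F ≤ L replaces 1 - F ≤ R.
      rcases Nat.lt_or_ge m k with hmk | hkm
      · rw [hgs k hk, hN2 _ (by omega), hLs]
        have : g k = F * (b k + R) / ((1 - p) * k * b k) := by
          simp only [hg]
          rw [hN2 k (by omega), ← hL, ← hLR]
          ring
        rw [this, abs_sub_comm]
        have hFL : F ≤ L := Finset.sum_le_sum_of_subset_of_nonneg
          (Finset.range_subset_range.2 (by omega)) fun j _ _ => hbn j
        have := abs_mul_div_sub_div_le hc ha hbk hF0 hFL hR0 (by linarith) (by linarith)
          (by linarith) (by linarith) l4 hd hdd.symm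
        convert this using 2
        rw [← hLR]
        ring
      · rw [hgs k hk, hN1 _ (by omega), hLs]
        have : g k = L * (1 - F) / ((1 - p) * k * b k) := by
          simp only [hg]
          rw [hN1 k (by omega)]
        rw [this]
        have hFR : 1 - F ≤ R := by
          have : L + b k ≤ F := by
            rw [← hLs]
            exact Finset.sum_le_sum_of_subset_of_nonneg
              (Finset.range_subset_range.2 (by omega)) fun j _ _ => hbn j
          linarith
        have := abs_mul_div_sub_div_le ha hc hbk (by linarith) hFR hL0 (by linarith) (by linarith)
          (by linarith) (by linarith) l3 hd hdd
        convert this using 2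
        ring

/-- A solution of the Stein equation with increments of order `1 / n` is of order `1 / √n`. -/
theorem abs_le_of_stein_equation {n : ℕ} {p d : ℝ} (hp : 0 < p) (hp1 : p < 1) (hd : 0 ≤ d)
    {g h : ℕ → ℝ} (hg0 : g 0 = 0)
    (hg : ∀ k < n, p * (n - k) * g (k + 1) - (1 - p) * k * g k = h k) (hh : ∀ k, |h k| ≤ 1)
    (hΔ : ∀ k < n, |g (k + 1) - g k| ≤ d / n) {k : ℕ} (hk : k < n) :
    |g k| ≤ (1 + 4 * d) / √n := by
  have hn : (0 : ℝ) < n := by exact_mod_cast (by omega : 0 < n)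
  set r := √(n : ℝ) with hr
  have hr0 : 0 < r := Real.sqrt_pos.2 hn
  have hr2 : r * r = n := Real.mul_self_sqrt hn.le
  have hr1 : 1 ≤ r := Real.one_le_sqrt.2 (by exact_mod_cast (by omega : 1 ≤ n))
  -- Away from the mean, write the equation as (np-k)g(k) = h(k) - p(n-k)(g(k+1)-g(k)); the right
  -- side is bounded by 1 + d, so one may divide by |np-k| ≥ √n.
  have hfar : ∀ k < n, r ≤ |n * p - k| → |g k| ≤ (1 + d) / r := by
    intro k hk hkr
    have hkn : (k : ℝ) < n := by exact_mod_cast hk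
    have e : (n * p - k) * g k = h k - p * (n - k) * (g (k + 1) - g k) := by
      rw [← hg k hk]; ring
    have h1 : |(n * p - k) * g k| ≤ 1 + d := by
      rw [e]
      refine (abs_sub _ _).trans (add_le_add (hh k) ?_)
      have hpn : 0 ≤ p * (n - k) := mul_nonneg hp.le (by linarith)
      rw [abs_mul, abs_of_nonneg hpn]
      have hpn' : p * (n - k) ≤ n := by
        have : (0 : ℝ) ≤ k := Nat.cast_nonneg k
        nlinarith
      calc p * (n - k) * |g (k + 1) - g k| ≤ n * (d / n) :=
            mul_le_mul hpn' (hΔ k hk) (abs_nonneg _) hn.le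
        _ = d := by field_simp
    rw [le_div_iff₀ hr0, mul_comm]
    rw [abs_mul] at h1
    exact (mul_le_mul_of_nonneg_right hkr (abs_nonneg _)).trans h1
  have hwalk : ∀ i j : ℕ, j + i < n → |g (j + i) - g j| ≤ i * (d / n) := by
    intro i
    induction i with
    | zero => intro j _; simp
    | succ i ih =>
      intro j hj
      have := abs_sub_le (g (j + (i + 1))) (g (j + i)) (g j)
      push_cast
      have h1 := hΔ (j + i) (by omega)
      have h2 := ih j (by omega)
      rw [add_assoc] at h1
      linarith
  by_cases hkr : r ≤ |n * p - k|
  · refine (hfar k hk hkr).trans ?_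
    gcongr
    linarith
  · push Not at hkr
    -- Near the mean, about 2√n steps to the left reach either the far region or 0, where g
    -- vanishes. As i ≤ 3√n, the walk costs at most 3d/√n.
    set i := ⌈2 * r⌉₊ with hi
    have hi1 : 2 * r ≤ i := Nat.le_ceil _
    have hi2 : (i : ℝ) < 2 * r + 1 := Nat.ceil_lt_add_one (by linarith)
    have hstep : ∀ l : ℕ, l ≤ i → (l : ℝ) * (d / n) ≤ 3 * d / r := by
      intro l hl
      have hl' : (l : ℝ) ≤ 3 * r := by
        have : (l : ℝ) ≤ i := by exact_mod_cast hl
        linarith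
      calc (l : ℝ) * (d / n) ≤ 3 * r * (d / n) := by gcongr
        _ = 3 * d / r := by rw [← hr2]; field_simp
    have hsum : (1 + d) / r + 3 * d / r = (1 + 4 * d) / r := by rw [← add_div]; ring_nf
    have hnn : 0 ≤ (1 + d) / r := by positivity
    rcases le_total k i with hki | hik
    · have h1 := hwalk k 0 (by omega)
      rw [zero_add, hg0, sub_zero] at h1
      linarith [hstep k hki]
    · obtain ⟨l, rfl⟩ := Nat.exists_eq_add_of_le' hik
      have h1 := hwalk i l hk
      have h2 : r ≤ |n * p - l| := by
        have := (abs_lt.1 hkr).1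
        push_cast at this
        exact le_trans (by linarith) (le_abs_self _)
      have h3 := hfar l (by omega) h2
      have h4 := abs_sub_abs_le_abs_sub (g (l + i)) (g l)
      linarith [hstep i le_rfl]

/-! ### Beta densities: Stein identity, concentration, comparison on the grid. -/

section BetaWeight

variable {i j n : ℕ}

/-- The unnormalized density of the beta distribution with parameters `i + 1` and `j + 1`. -/
noncomputable def betaWeight (i j : ℕ) (x : ℝ) : ℝ := x ^ i * (1 - x) ^ j

@[fun_prop]
lemma continuous_betaWeight (i j : ℕ) : Continuous (betaWeight i j) := by
  unfold betaWeight; fun_prop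

lemma betaWeight_nonneg {x : ℝ} (hx : x ∈ Set.Icc (0 : ℝ) 1) : 0 ≤ betaWeight i j x :=
  mul_nonneg (pow_nonneg hx.1 _) (pow_nonneg (by linarith [hx.2]) _)

/-- This is the source of the beta Stein operator: with n = i+j+2 and np = i+1, the derivative is
n(p-x) times the weight. -/
lemma hasDerivAt_mul_betaWeight (i j : ℕ) (x : ℝ) :
    HasDerivAt (fun x => x * (1 - x) * betaWeight i j x)
      (((i + 1 : ℝ) - (i + j + 2) * x) * betaWeight i j x) x := by
  have h1 : HasDerivAt (fun x : ℝ => x ^ (i + 1) * (1 - x) ^ (j + 1))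
      (((i + 1 : ℕ) : ℝ) * x ^ i * (1 - x) ^ (j + 1)
        + x ^ (i + 1) * (((j + 1 : ℕ) : ℝ) * (1 - x) ^ j * (-1))) x := by
    have h2 := (hasDerivAt_pow (i + 1) x)
    have h3 : HasDerivAt (fun x : ℝ => 1 - x) (-1) x := by
      simpa using (hasDerivAt_id x).const_sub 1
    exact h2.mul (h3.pow (j + 1))
  convert h1 using 1
  · funext y
    unfold betaWeight
    ring
  · unfold betaWeight
    push_cast
    ring

/-- Integration by parts against the beta density, for a function affine on each cell of the
grid of mesh `1 / n`. -/
lemma sum_integral_affine_betaWeight (hn : n = i + j + 2) (g : ℕ → ℝ) :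
    ∑ k ∈ Finset.range n, ∫ x in ((k : ℝ) / n)..(((k + 1 : ℕ) : ℝ) / n),
      (n * (g (k + 1) - g k) * (x * (1 - x))
        + ((i + 1) - n * x) * (g k + (n * x - k) * (g (k + 1) - g k))) * betaWeight i j x = 0 := by
  have hn0 : (n : ℝ) ≠ 0 := by
    have : n ≠ 0 := by omega
    exact_mod_cast this
  have hcast : (n : ℝ) = i + j + 2 := by rw [hn]; push_cast; ring
  set φ : ℝ → ℝ := fun x => x * (1 - x) * betaWeight i j x with hφ
  have hcell : ∀ k : ℕ, ∫ x in ((k : ℝ) / n)..(((k + 1 : ℕ) : ℝ) / n),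
      (n * (g (k + 1) - g k) * (x * (1 - x))
        + ((i + 1) - n * x) * (g k + (n * x - k) * (g (k + 1) - g k))) * betaWeight i j x
      = g (k + 1) * φ (((k + 1 : ℕ) : ℝ) / n) - g k * φ ((k : ℝ) / n) := by
    intro k
    have hd : ∀ x ∈ Set.uIcc ((k : ℝ) / n) (((k + 1 : ℕ) : ℝ) / n),
        HasDerivAt (fun x => (g k + (n * x - k) * (g (k + 1) - g k)) * φ x)
        ((n * (g (k + 1) - g k) * (x * (1 - x))
        + ((i + 1) - n * x) * (g k + (n * x - k) * (g (k + 1) - g k))) * betaWeight i j x) x := by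
      intro x _
      have h1 : HasDerivAt (fun x : ℝ => g k + (n * x - k) * (g (k + 1) - g k))
          (n * (g (k + 1) - g k)) x := by
        have h := ((((hasDerivAt_id x).const_mul (n : ℝ)).sub_const (k : ℝ)).mul_const
          (g (k + 1) - g k)).const_add (g k)
        simpa using h
      refine (h1.mul (hasDerivAt_mul_betaWeight i j x)).congr_deriv ?_
      rw [hcast]
      ring
    rw [intervalIntegral.integral_eq_sub_of_hasDerivAt hd
      (Continuous.intervalIntegrable (by fun_prop) _ _)]
    have e1 : (n : ℝ) * (((k + 1 : ℕ) : ℝ) / n) = k + 1 := by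
      rw [mul_div_cancel₀ _ hn0]; push_cast; ring
    have e2 : (n : ℝ) * ((k : ℝ) / n) = k := by rw [mul_div_cancel₀ _ hn0]
    rw [e1, e2]
    ring
  -- The boundary terms telescope, and φ vanishes at both 0 and 1.
  rw [Finset.sum_congr rfl fun k _ => hcell k,
    Finset.sum_range_sub (fun k : ℕ => g k * φ ((k : ℝ) / n))]
  simp [hφ, hn0]

lemma sum_integral_cells (hn : 0 < n) {f : ℝ → ℝ} (hf : Continuous f) :
    ∑ k ∈ Finset.range n, ∫ x in ((k : ℝ) / n)..(((k + 1 : ℕ) : ℝ) / n), f x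
      = ∫ x in (0 : ℝ)..1, f x := by
  have hn0 : (n : ℝ) ≠ 0 := by exact_mod_cast hn.ne'
  have := intervalIntegral.sum_integral_adjacent_intervals (f := f) (μ := volume) (n := n)
    (a := fun k : ℕ => (k : ℝ) / n) fun k _ => hf.intervalIntegrable _ _
  simpa [hn0] using this

lemma integral_betaWeight_pos (i j : ℕ) : 0 < ∫ x in (0 : ℝ)..1, betaWeight i j x := by
  refine intervalIntegral.intervalIntegral_pos_of_pos_on
    ((continuous_betaWeight i j).intervalIntegrable _ _) (fun x hx => ?_) one_pos
  exact mul_pos (pow_pos hx.1 _) (pow_pos (by linarith [hx.2]) _)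

/-- The variance of a beta distribution is at most `1 / (4 n)`. -/
lemma integral_sq_betaWeight_le {p : ℝ} (hn : n = i + j + 2) (hp : n * p = i + 1) :
    ∫ x in (0 : ℝ)..1, (x - p) ^ 2 * betaWeight i j x
      ≤ 1 / (4 * n) * ∫ x in (0 : ℝ)..1, betaWeight i j x := by
  have hn0 : (0 : ℝ) < n := by exact_mod_cast (by omega : 0 < n)
  have hcast : (n : ℝ) = i + j + 2 := by rw [hn]; push_cast; ring
  -- The Stein identity for the test function x - p expresses n times the variance as the mean of
  -- x(1-x), which is at most 1/4.
  have hd : ∀ x ∈ Set.uIcc (0 : ℝ) 1,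
      HasDerivAt (fun x => (x - p) * (x * (1 - x) * betaWeight i j x))
        (x * (1 - x) * betaWeight i j x - n * ((x - p) ^ 2 * betaWeight i j x)) x := by
    intro x _
    refine (((hasDerivAt_id x).sub_const p).mul (hasDerivAt_mul_betaWeight i j x)).congr_deriv ?_
    simp only [id]
    rw [← hcast, ← hp]
    ring
  have h1 := intervalIntegral.integral_eq_sub_of_hasDerivAt hd
      (Continuous.intervalIntegrable (by fun_prop) _ _)
  rw [intervalIntegral.integral_sub (Continuous.intervalIntegrable (by fun_prop) _ _)
    (Continuous.intervalIntegrable (by fun_prop) _ _), intervalIntegral.integral_const_mul] at h1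
  have h2 : ∫ x in (0 : ℝ)..1, x * (1 - x) * betaWeight i j x
      ≤ ∫ x in (0 : ℝ)..1, 1 / 4 * betaWeight i j x := by
    refine intervalIntegral.integral_mono_on zero_le_one
      (Continuous.intervalIntegrable (by fun_prop) _ _)
      (Continuous.intervalIntegrable (by fun_prop) _ _) fun x hx => ?_
    refine mul_le_mul_of_nonneg_right ?_ (betaWeight_nonneg hx)
    nlinarith [sq_nonneg (x - 1 / 2)]
  rw [intervalIntegral.integral_const_mul] at h2
  simp only [zero_mul, mul_zero, sub_self, sub_zero] at h1
  rw [show 1 / (4 * (n : ℝ)) * (∫ x in (0 : ℝ)..1, betaWeight i j x)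
    = (1 / 4 * ∫ x in (0 : ℝ)..1, betaWeight i j x) / n by field_simp, le_div_iff₀ hn0]
  linarith

/-- Follows from the variance bound and |u| ≤ (r/2)u² + 1/(2r) with r = √n; this yields 5/8 in place
of the stated 1. -/
lemma integral_abs_betaWeight_le {p : ℝ} (hn : n = i + j + 2) (hp : n * p = i + 1) :
    ∫ x in (0 : ℝ)..1, |x - p| * betaWeight i j x
      ≤ 1 / √n * ∫ x in (0 : ℝ)..1, betaWeight i j x := by
  have hn0 : (0 : ℝ) < n := by exact_mod_cast (by omega : 0 < n)
  set r := √(n : ℝ) with hr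
  have hr0 : 0 < r := Real.sqrt_pos.2 hn0
  have hr2 : r * r = n := Real.mul_self_sqrt hn0.le
  have h1 : ∫ x in (0 : ℝ)..1, |x - p| * betaWeight i j x
      ≤ ∫ x in (0 : ℝ)..1, (r / 2 * ((x - p) ^ 2 * betaWeight i j x)
        + 1 / (2 * r) * betaWeight i j x) := by
    refine intervalIntegral.integral_mono_on zero_le_one
      (Continuous.intervalIntegrable (by fun_prop) _ _)
      (Continuous.intervalIntegrable (by fun_prop) _ _) fun x hx => ?_
    rw [← mul_assoc, ← add_mul]
    refine mul_le_mul_of_nonneg_right ?_ (betaWeight_nonneg hx)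
    have h := sq_nonneg (r * |x - p| - 1)
    have e : r / 2 * (x - p) ^ 2 + 1 / (2 * r) - |x - p| = (r * |x - p| - 1) ^ 2 / (2 * r) := by
      rw [← sq_abs (x - p)]
      field_simp
      ring
    have : 0 ≤ (r * |x - p| - 1) ^ 2 / (2 * r) := by positivity
    linarith
  rw [intervalIntegral.integral_add (Continuous.intervalIntegrable (by fun_prop) _ _)
    (Continuous.intervalIntegrable (by fun_prop) _ _), intervalIntegral.integral_const_mul,
    intervalIntegral.integral_const_mul] at h1
  have h2 := mul_le_mul_of_nonneg_left (integral_sq_betaWeight_le hn hp)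
    (show 0 ≤ r / 2 by positivity)
  have h3 := integral_betaWeight_pos i j
  have e : r / 2 * (1 / (4 * n) * ∫ x in (0 : ℝ)..1, betaWeight i j x)
      + 1 / (2 * r) * ∫ x in (0 : ℝ)..1, betaWeight i j x
      = 5 / 8 * (1 / r * ∫ x in (0 : ℝ)..1, betaWeight i j x) := by
    rw [← hr2]; field_simp; ring
  have h4 : 0 ≤ 1 / r * ∫ x in (0 : ℝ)..1, betaWeight i j x := by positivity
  linarith

lemma mem_cell {k : ℕ} (hk : k < n) {x : ℝ}
    (hx : x ∈ Set.Icc ((k : ℝ) / n) (((k + 1 : ℕ) : ℝ) / n)) :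
    x ∈ Set.Icc (0 : ℝ) 1 ∧ 0 ≤ n * x - k ∧ n * x - k ≤ 1 := by
  have hn0 : (0 : ℝ) < n := by exact_mod_cast (by omega : 0 < n)
  have h1 := (div_le_iff₀ hn0).1 hx.1
  have h2 := (le_div_iff₀ hn0).1 hx.2
  have h3 : ((k + 1 : ℕ) : ℝ) ≤ n := by exact_mod_cast hk
  have h4 : (0 : ℝ) ≤ k := Nat.cast_nonneg k
  push_cast at h2 h3
  refine ⟨⟨?_, ?_⟩, by linarith, by linarith⟩
  · exact le_trans (by positivity) hx.1
  · by_contra! h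
    nlinarith

/-- A bound for a sum of integrals over the cells of the grid, from a pointwise bound. -/
lemma abs_sum_integral_cells_le {p a c : ℝ} (hn : n = i + j + 2) (hp : n * p = i + 1) (ha : 0 ≤ a)
    {e : ℕ → ℝ → ℝ} (he : ∀ k, Continuous (e k))
    (hle : ∀ k < n, ∀ x ∈ Set.Icc ((k : ℝ) / n) (((k + 1 : ℕ) : ℝ) / n),
      |e k x| ≤ a * |x - p| + c) :
    |∑ k ∈ Finset.range n, ∫ x in ((k : ℝ) / n)..(((k + 1 : ℕ) : ℝ) / n), e k x * betaWeight i j x|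
      ≤ (a / √n + c) * ∫ x in (0 : ℝ)..1, betaWeight i j x := by
  have hn0 : (0 : ℝ) < n := by exact_mod_cast (by omega : 0 < n)
  have h1 : ∀ k ∈ Finset.range n,
      |∫ x in ((k : ℝ) / n)..(((k + 1 : ℕ) : ℝ) / n), e k x * betaWeight i j x|
      ≤ ∫ x in ((k : ℝ) / n)..(((k + 1 : ℕ) : ℝ) / n), (a * |x - p| + c) * betaWeight i j x := by
    intro k hk
    have hk' := Finset.mem_range.1 hk
    have hle' : (k : ℝ) / n ≤ ((k + 1 : ℕ) : ℝ) / n := by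
      gcongr; simp
    refine (intervalIntegral.abs_integral_le_integral_abs hle').trans ?_
    have hc := he k
    refine intervalIntegral.integral_mono_on hle'
      (Continuous.intervalIntegrable (by fun_prop) _ _)
      (Continuous.intervalIntegrable (by fun_prop) _ _) fun x hx => ?_
    have hw := betaWeight_nonneg (i := i) (j := j) (mem_cell hk' hx).1
    rw [abs_mul, abs_of_nonneg hw]
    exact mul_le_mul_of_nonneg_right (hle k hk' x hx) hw
  refine (Finset.abs_sum_le_sum_abs _ _).trans ((Finset.sum_le_sum h1).trans ?_)
  rw [sum_integral_cells (by omega) (f := fun x => (a * |x - p| + c) * betaWeight i j x)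
    (by fun_prop)]
  have h2 : ∫ x in (0 : ℝ)..1, (a * |x - p| + c) * betaWeight i j x
      = a * (∫ x in (0 : ℝ)..1, |x - p| * betaWeight i j x)
        + c * ∫ x in (0 : ℝ)..1, betaWeight i j x := by
    rw [← intervalIntegral.integral_const_mul, ← intervalIntegral.integral_const_mul,
      ← intervalIntegral.integral_add (Continuous.intervalIntegrable (by fun_prop) _ _)
      (Continuous.intervalIntegrable (by fun_prop) _ _)]
    refine intervalIntegral.integral_congr fun x _ => ?_
    ring
  have h3 := mul_le_mul_of_nonneg_left (integral_abs_betaWeight_le hn hp) ha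
  rw [h2, add_mul]
  have e3 : a * (1 / √n * ∫ x in (0 : ℝ)..1, betaWeight i j x)
      = a / √n * ∫ x in (0 : ℝ)..1, betaWeight i j x := by ring
  linarith

/-- A beta distribution does not concentrate on a cell of length `1 / n`. -/
theorem integral_cell_betaWeight_le {p : ℝ} (hn : n = i + j + 2) (hp : n * p = i + 1)
    (hp0 : 0 < p) (hp1 : p < 1) {m : ℕ} (hm : m < n) :
    ∫ x in ((m : ℝ) / n)..(((m + 1 : ℕ) : ℝ) / n), betaWeight i j x
      ≤ 2 / (p * (1 - p)) / √n * ∫ x in (0 : ℝ)..1, betaWeight i j x := by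
  have hn0 : (0 : ℝ) < n := by exact_mod_cast (by omega : 0 < n)
  have hq : 0 < 1 - p := by linarith
  set B := ∫ x in (0 : ℝ)..1, betaWeight i j x with hB
  -- The interpolation of g is a ramp climbing from 0 to 1 on the cell m alone. In the Stein
  -- identity its derivative isolates that cell, while the other term is at most n times the mean of
  -- |x-p|.
  set g : ℕ → ℝ := fun k => if k ≤ m then 0 else 1 with hg
  have key := sum_integral_affine_betaWeight hn g
  have hsplit : ∀ k, ∫ x in ((k : ℝ) / n)..(((k + 1 : ℕ) : ℝ) / n),
      (n * (g (k + 1) - g k) * (x * (1 - x))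
        + ((i + 1) - n * x) * (g k + (n * x - k) * (g (k + 1) - g k))) * betaWeight i j x
      = (if k = m then n * ∫ x in ((k : ℝ) / n)..(((k + 1 : ℕ) : ℝ) / n),
          x * (1 - x) * betaWeight i j x else 0)
      + ∫ x in ((k : ℝ) / n)..(((k + 1 : ℕ) : ℝ) / n),
        (((i + 1) - n * x) * (g k + (n * x - k) * (g (k + 1) - g k))) * betaWeight i j x := by
    intro k
    have : (if k = m then n * ∫ x in ((k : ℝ) / n)..(((k + 1 : ℕ) : ℝ) / n),
          x * (1 - x) * betaWeight i j x else 0)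
        = ∫ x in ((k : ℝ) / n)..(((k + 1 : ℕ) : ℝ) / n),
          (n * (g (k + 1) - g k)) * (x * (1 - x) * betaWeight i j x) := by
      rw [intervalIntegral.integral_const_mul]
      simp only [hg]
      split_ifs <;> first | omega | simp
    rw [this, ← intervalIntegral.integral_add (Continuous.intervalIntegrable (by fun_prop) _ _)
      (Continuous.intervalIntegrable (by fun_prop) _ _)]
    refine intervalIntegral.integral_congr fun x _ => ?_
    ring
  rw [Finset.sum_congr rfl fun k _ => hsplit k, Finset.sum_add_distrib,
    Finset.sum_ite_eq' , if_pos (Finset.mem_range.2 hm)] at key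
  have hbound := abs_sum_integral_cells_le (i := i) (j := j) (p := p) (a := n) (c := 0) hn hp hn0.le
    (e := fun k x => ((i + 1) - n * x) * (g k + (n * x - k) * (g (k + 1) - g k)))
    (fun k => by fun_prop) (by
      intro k hk x hx
      obtain ⟨_, h1, h2⟩ := mem_cell hk hx
      have hf : |g k + (n * x - k) * (g (k + 1) - g k)| ≤ 1 := by
        simp only [hg]
        rw [abs_le]
        split_ifs <;> first | omega | constructor <;> linarith
      rw [abs_mul, ← hp, ← mul_sub, abs_mul, abs_of_pos hn0, abs_sub_comm p x, add_zero]
      exact mul_le_of_le_one_right (by positivity) hf)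
  have h1 : n * ∫ x in ((m : ℝ) / n)..(((m + 1 : ℕ) : ℝ) / n), x * (1 - x) * betaWeight i j x
      ≤ n * (1 / √n * B) := by
    have := (abs_le.1 hbound).1
    have e : ((n : ℝ) / √n + 0) * B = n * (1 / √n * B) := by ring
    rw [← hB] at this
    linarith
  have h2 := le_of_mul_le_mul_left h1 hn0
  have hle' : (m : ℝ) / n ≤ ((m + 1 : ℕ) : ℝ) / n := by
    gcongr; simp
  have h3 : ∫ x in ((m : ℝ) / n)..(((m + 1 : ℕ) : ℝ) / n), |x - p| * betaWeight i j x
      ≤ ∫ x in (0 : ℝ)..1, |x - p| * betaWeight i j x := by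
    rw [← sum_integral_cells (n := n) (by omega) (f := fun x => |x - p| * betaWeight i j x)
      (by fun_prop)]
    refine Finset.single_le_sum (f := fun k : ℕ => ∫ x in ((k : ℝ) / n)..(((k + 1 : ℕ) : ℝ) / n),
      |x - p| * betaWeight i j x) (fun k hk => ?_) (Finset.mem_range.2 hm)
    refine intervalIntegral.integral_nonneg (by gcongr; simp) fun x hx => ?_
    exact mul_nonneg (abs_nonneg _) (betaWeight_nonneg (mem_cell (Finset.mem_range.1 hk) hx).1)
  have h4 := integral_abs_betaWeight_le hn hp
  -- Removes the factor x(1-x): it is 1-Lipschitz on [0,1], so p(1-p) ≤ x(1-x) + |x-p|.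
  have h5 : ∫ x in ((m : ℝ) / n)..(((m + 1 : ℕ) : ℝ) / n), p * (1 - p) * betaWeight i j x
      ≤ ∫ x in ((m : ℝ) / n)..(((m + 1 : ℕ) : ℝ) / n), (x * (1 - x) * betaWeight i j x
        + |x - p| * betaWeight i j x) := by
    refine intervalIntegral.integral_mono_on hle'
      (Continuous.intervalIntegrable (by fun_prop) _ _)
      (Continuous.intervalIntegrable (by fun_prop) _ _) fun x hx => ?_
    obtain ⟨hx01, _⟩ := mem_cell hm hx
    rw [← add_mul]
    refine mul_le_mul_of_nonneg_right ?_ (betaWeight_nonneg hx01)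
    rcases abs_cases (x - p) with ⟨h, _⟩ | ⟨h, _⟩ <;> rw [h] <;> nlinarith [hx01.1, hx01.2]
  rw [intervalIntegral.integral_const_mul,
    intervalIntegral.integral_add (Continuous.intervalIntegrable (by fun_prop) _ _)
      (Continuous.intervalIntegrable (by fun_prop) _ _)] at h5
  have hpq : 0 < p * (1 - p) := mul_pos hp0 hq
  have e : 2 / (p * (1 - p)) / √n * B = (2 * (1 / √n * B)) / (p * (1 - p)) := by ring
  rw [e, le_div_iff₀ hpq]
  linarith

/-- The beta and binomial distribution functions are close at the points of the grid. -/
theorem abs_integral_betaWeight_sub_le {p : ℝ} (hn : n = i + j + 2) (hp : n * p = i + 1)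
    (hp0 : 0 < p) (hp1 : p < 1) {m : ℕ} (hm : m < n) :
    |(∫ x in (0 : ℝ)..(((m + 1 : ℕ) : ℝ) / n), betaWeight i j x)
      - (∑ k ∈ Finset.range (m + 1), binomialWeight n p k) * ∫ x in (0 : ℝ)..1, betaWeight i j x|
      ≤ (1 + 7 * (2 / (p * (1 - p)))) / √n * ∫ x in (0 : ℝ)..1, betaWeight i j x := by
  have hn0 : (0 : ℝ) < n := by exact_mod_cast (by omega : 0 < n)
  have hq : 0 < 1 - p := by linarith
  set B := ∫ x in (0 : ℝ)..1, betaWeight i j x with hB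
  set F := ∑ k ∈ Finset.range (m + 1), binomialWeight n p k with hF
  set d := 2 / (p * (1 - p)) with hd
  have hd0 : 0 ≤ d := by positivity
  obtain ⟨g, hg0, hgeq, hgΔ⟩ := exists_binomial_stein_solution (n := n) hp0 hp1 hm
  have hΔ : ∀ k < n, |g (k + 1) - g k| ≤ d / n := by
    intro k hk
    have e : d / n = 2 / (n * (p * (1 - p))) := by
      rw [hd]; field_simp
    rw [e]; exact hgΔ k hk
  have hF0 : 0 ≤ F := Finset.sum_nonneg fun k _ => binomialWeight_nonneg hp0 hp1 k
  have hF1 : F ≤ 1 := sum_le_one_of_subset hp0 hp1 (Finset.range_subset_range.2 (by omega))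
  set h : ℕ → ℝ := fun k => (if k ≤ m then 1 else 0) - F with hh
  have hgb : ∀ k < n, |g k| ≤ (1 + 4 * d) / √n := fun k hk =>
    abs_le_of_stein_equation hp0 hp1 hd0 hg0 (h := h) hgeq (fun k => by
      simp only [hh]
      rw [abs_le]
      split_ifs <;> constructor <;> linarith) hΔ hk
  -- The values k ≤ m correspond to the cells that fill [0, (m+1)/n], whence the upper limit m + 1.
  have hlhs : (∫ x in (0 : ℝ)..(((m + 1 : ℕ) : ℝ) / n), betaWeight i j x) - F * B
      = ∑ k ∈ Finset.range n, h k * ∫ x in ((k : ℝ) / n)..(((k + 1 : ℕ) : ℝ) / n),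
        betaWeight i j x := by
    simp only [hh, sub_mul]
    rw [Finset.sum_sub_distrib, ← Finset.mul_sum,
      sum_integral_cells (by omega) (continuous_betaWeight i j)]
    congr 1
    have h1 := intervalIntegral.sum_integral_adjacent_intervals (f := betaWeight i j) (μ := volume)
      (n := m + 1) (a := fun k : ℕ => (k : ℝ) / n)
      fun k _ => (continuous_betaWeight i j).intervalIntegrable _ _
    simp only [Nat.cast_zero, zero_div] at h1
    rw [← h1]
    simp only [ite_mul, one_mul, zero_mul]
    rw [← Finset.sum_filter]
    refine Finset.sum_congr ?_ fun _ _ => rfl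
    ext k
    simp only [Finset.mem_range, Finset.mem_filter]
    omega
  -- The binomial operator at k minus the beta operator at x, where x lies in cell k. Increments
  -- O(1/n), g = O(1/√n) and mean |x-p| at most 1/√n make its mean O(1/√n); the constants 2d and 1 +
  -- 5d add up to 1 + 7d.
  set E : ℕ → ℝ → ℝ := fun k x =>
    (n * (1 - x) * (p - x) + p * (n * x - k) - n * (p - x) * (n * x - k)) * (g (k + 1) - g k)
      + (n * x - k) * g k with hE
  have hEc : ∀ k, Continuous (E k) := fun k => by simp only [hE]; fun_prop
  have hrhs : ∑ k ∈ Finset.range n, h k * ∫ x in ((k : ℝ) / n)..(((k + 1 : ℕ) : ℝ) / n),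
        betaWeight i j x
      = ∑ k ∈ Finset.range n, ∫ x in ((k : ℝ) / n)..(((k + 1 : ℕ) : ℝ) / n),
        E k x * betaWeight i j x := by
    rw [← sub_eq_zero, ← Finset.sum_sub_distrib, ← sum_integral_affine_betaWeight hn g]
    refine Finset.sum_congr rfl fun k hk => ?_
    have hEk := hEc k
    rw [← intervalIntegral.integral_const_mul, ← intervalIntegral.integral_sub
      (Continuous.intervalIntegrable (by fun_prop) _ _)
      (Continuous.intervalIntegrable (by fun_prop) _ _)]
    refine intervalIntegral.integral_congr fun x _ => ?_
    simp only [hE, hh]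
    rw [← hgeq k (Finset.mem_range.1 hk), ← hp]
    ring
  rw [hlhs, hrhs]
  have hr0 : 0 < √(n : ℝ) := Real.sqrt_pos.2 hn0
  refine (abs_sum_integral_cells_le hn hp (a := 2 * d) (c := (1 + 5 * d) / √n) (by positivity) hEc
    ?_).trans (le_of_eq ?_)
  · intro k hk x hx
    obtain ⟨⟨hx0, hx1⟩, ht0, ht1⟩ := mem_cell hk hx
    set t := n * x - k with ht
    have hu : |n * (1 - x) * (p - x) + p * t - n * (p - x) * t| ≤ 2 * n * |x - p| + 1 := by
      have h1 : |n * (1 - x) * (p - x) - n * (p - x) * t| ≤ 2 * n * |x - p| := by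
        have e : n * (1 - x) * (p - x) - n * (p - x) * t = (1 - x - t) * n * (p - x) := by ring
        rw [e, abs_mul, abs_mul, abs_of_pos hn0, abs_sub_comm p x]
        have : |1 - x - t| ≤ 2 := abs_le.2 ⟨by linarith, by linarith⟩
        gcongr
      have h2 : |p * t| ≤ 1 := by
        rw [abs_of_nonneg (mul_nonneg hp0.le ht0)]
        nlinarith
      have e : n * (1 - x) * (p - x) + p * t - n * (p - x) * t
          = (n * (1 - x) * (p - x) - n * (p - x) * t) + p * t := by ring
      rw [e]
      exact (abs_add_le _ _).trans (add_le_add h1 h2)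
    have hdn : d / n ≤ d / √n := by
      refine div_le_div_of_nonneg_left hd0 hr0 ?_
      have h1 : 1 ≤ √(n : ℝ) := Real.one_le_sqrt.2 (by exact_mod_cast (by omega : 1 ≤ n))
      have h2 : √(n : ℝ) * √n = n := Real.mul_self_sqrt hn0.le
      nlinarith
    calc |E k x| ≤ |n * (1 - x) * (p - x) + p * t - n * (p - x) * t| * |g (k + 1) - g k|
          + |t| * |g k| := by
          simp only [hE]
          rw [← abs_mul, ← abs_mul]
          exact abs_add_le _ _
      _ ≤ (2 * n * |x - p| + 1) * (d / n) + 1 * ((1 + 4 * d) / √n) := by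
          refine add_le_add (mul_le_mul hu (hΔ k hk) (abs_nonneg _) (by positivity))
            (mul_le_mul ?_ (hgb k hk) (abs_nonneg _) zero_le_one)
          rw [abs_of_nonneg ht0]; exact ht1
      _ = 2 * d * |x - p| + d / n + (1 + 4 * d) / √n := by field_simp
      _ ≤ 2 * d * |x - p| + (1 + 5 * d) / √n := by
          have : (1 + 5 * d) / √n = d / √n + (1 + 4 * d) / √n := by rw [← add_div]; ring_nf
          linarith
  · rw [← add_div]
    ring

end BetaWeight

/-! ### Kolmogorov distance between the two laws of one arm. -/

section Laws

lemma betaPDFReal_natCast (i j : ℕ) :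
    betaPDFReal ((i : ℝ) + 1) ((j : ℝ) + 1) = Set.indicator (Set.Ioo 0 1)
      (fun x => 1 / beta ((i : ℝ) + 1) ((j : ℝ) + 1) * betaWeight i j x) := by
  funext x
  unfold betaPDFReal Set.indicator betaWeight
  simp only [Set.mem_Ioo, add_sub_cancel_right, Real.rpow_natCast, mul_assoc]

lemma betaMeasure_real_apply (i j : ℕ) {S : Set ℝ} (hS : MeasurableSet S) :
    (betaMeasure ((i : ℝ) + 1) ((j : ℝ) + 1)).real S
      = 1 / beta ((i : ℝ) + 1) ((j : ℝ) + 1) * ∫ x in S ∩ Set.Ioo 0 1, betaWeight i j x := by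
  have hc : 0 < beta ((i : ℝ) + 1) ((j : ℝ) + 1) := beta_pos (by positivity) (by positivity)
  rw [measureReal_def, betaMeasure, withDensity_apply _ hS, ← integral_const_mul,
    ← setIntegral_indicator measurableSet_Ioo, ← betaPDFReal_natCast,
    integral_eq_lintegral_of_nonneg_ae _ (by fun_prop)]
  · rfl
  · refine Filter.Eventually.of_forall fun x => ?_
    rw [betaPDFReal_natCast]
    refine Set.indicator_nonneg (fun x hx => ?_) x
    exact mul_nonneg (by positivity) (betaWeight_nonneg (Set.Ioo_subset_Icc_self hx))

lemma integral_betaWeight_eq_beta (i j : ℕ) :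
    ∫ x in (0 : ℝ)..1, betaWeight i j x = beta ((i : ℝ) + 1) ((j : ℝ) + 1) := by
  have hc : 0 < beta ((i : ℝ) + 1) ((j : ℝ) + 1) := beta_pos (by positivity) (by positivity)
  have := isProbabilityMeasureBeta (α := (i : ℝ) + 1) (β := (j : ℝ) + 1) (by positivity)
    (by positivity)
  have h := betaMeasure_real_apply i j MeasurableSet.univ
  rw [probReal_univ, Set.univ_inter, ← integral_Ioc_eq_integral_Ioo,
    ← intervalIntegral.integral_of_le zero_le_one] at h
  field_simp at h
  exact h.symm

lemma betaMeasure_real_Iic (i j : ℕ) {y : ℝ} (h0 : 0 ≤ y) (h1 : y ≤ 1) :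
    (betaMeasure ((i : ℝ) + 1) ((j : ℝ) + 1)).real (Set.Iic y)
      = (∫ x in (0 : ℝ)..y, betaWeight i j x) / ∫ x in (0 : ℝ)..1, betaWeight i j x := by
  rw [betaMeasure_real_apply i j measurableSet_Iic, integral_betaWeight_eq_beta,
    intervalIntegral.integral_of_le h0, one_div_mul_eq_div]
  congr 1
  rw [integral_Ioc_eq_integral_Ioo]
  rcases h1.eq_or_lt with rfl | h1
  · congr 2
    ext x
    simp only [Set.mem_inter_iff, Set.mem_Iic, Set.mem_Ioo]
    exact ⟨fun h => h.2, fun h => ⟨h.2.le, h⟩⟩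
  · rw [← integral_Ioc_eq_integral_Ioo]
    congr 2
    ext x
    simp only [Set.mem_inter_iff, Set.mem_Iic, Set.mem_Ioo, Set.mem_Ioc]
    exact ⟨fun h => ⟨h.2.1, h.1⟩, fun h => ⟨h.2, h.1, h.2.trans_lt h1⟩⟩

lemma bootstrapLaw_real_Iic {n : ℕ} (hn : 0 < n) (p : unitInterval) {z : ℝ} (hz : 0 ≤ z) :
    (bootstrapLaw n p).real (Set.Iic z)
      = ∑ k ∈ Finset.range (⌊n * z⌋₊ + 1), binomialWeight n p k := by
  have hn0 : (0 : ℝ) < n := by exact_mod_cast hn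
  rw [bootstrapLaw, map_measureReal_apply (by fun_prop) measurableSet_Iic]
  have : (fun k : ℕ => (k : ℝ) / (n : ℝ)) ⁻¹' Set.Iic z
      = ((Finset.range (⌊n * z⌋₊ + 1) : Finset ℕ) : Set ℕ) := by
    ext k
    simp only [Set.mem_preimage, Set.mem_Iic, Finset.coe_range, Set.mem_Iio, Nat.lt_succ_iff]
    rw [Nat.le_floor_iff (by positivity), div_le_iff₀ hn0, mul_comm]
  rw [this, ← sum_measureReal_singleton]
  refine Finset.sum_congr rfl fun k _ => ?_
  rw [binomial_real_singleton]
  rfl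

instance isProbabilityMeasure_bootstrapLaw (n : ℕ) (p : unitInterval) :
    IsProbabilityMeasure (bootstrapLaw n p) :=
  Measure.isProbabilityMeasure_map (by fun_prop)

/-- The constant in the comparison of the two laws of an arm. -/
noncomputable def armConstant (p : ℝ) : ℝ := 1 + 8 * (2 / (p * (1 - p)))

lemma armConstant_nonneg {p : ℝ} (hp0 : 0 < p) (hp1 : p < 1) : 0 ≤ armConstant p := by
  have : 0 < 1 - p := by linarith
  unfold armConstant
  positivity

/-- The condition 0 < p < 1 forces 1 ≤ s ≤ n - 1, so the exponents s - 1 and n - s - 1 of the beta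
density are natural numbers and the polynomial weights apply. -/
lemma exists_thompsonLaw_eq {n s : ℕ} {p : unitInterval} (hn : 2 ≤ n)
    (hp : (p : ℝ) = (s : ℝ) / (n : ℝ)) (hp0 : 0 < (p : ℝ)) (hp1 : (p : ℝ) < 1) :
    ∃ i j : ℕ, n = i + j + 2 ∧ (n : ℝ) * p = i + 1 ∧
      thompsonLaw n p = betaMeasure ((i : ℝ) + 1) ((j : ℝ) + 1) := by
  have hn0 : (0 : ℝ) < n := by exact_mod_cast (by omega : 0 < n)
  have hnp : (n : ℝ) * p = s := by rw [hp]; field_simp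
  have hs0 : 0 < s := by
    have : (0 : ℝ) < s := by rw [← hnp]; positivity
    exact_mod_cast this
  have hsn : s < n := by
    have : (s : ℝ) < n := by rw [← hnp]; nlinarith
    exact_mod_cast this
  obtain ⟨i, rfl⟩ : ∃ i, s = i + 1 := ⟨s - 1, by omega⟩
  obtain ⟨j, rfl⟩ : ∃ j, n = i + j + 2 := ⟨n - i - 2, by omega⟩
  push_cast at hnp
  refine ⟨i, j, rfl, by exact_mod_cast hnp, ?_⟩
  unfold thompsonLaw
  push_cast
  rw [mul_sub, hnp]
  congr 1
  ring

lemma isProbabilityMeasure_thompsonLaw {n s : ℕ} {p : unitInterval} (hn : 2 ≤ n)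
    (hp : (p : ℝ) = (s : ℝ) / (n : ℝ)) (hp0 : 0 < (p : ℝ)) (hp1 : (p : ℝ) < 1) :
    IsProbabilityMeasure (thompsonLaw n p) := by
  obtain ⟨i, j, _, _, h⟩ := exists_thompsonLaw_eq hn hp hp0 hp1
  rw [h]
  exact isProbabilityMeasureBeta (by positivity) (by positivity)

/-- The Kolmogorov distance between the two laws of an arm is of order `1 / √n`. -/
theorem abs_thompsonLaw_real_Iic_sub_le {n s : ℕ} {p : unitInterval} (hn : 2 ≤ n)
    (hp : (p : ℝ) = (s : ℝ) / (n : ℝ)) (hp0 : 0 < (p : ℝ)) (hp1 : (p : ℝ) < 1) (z : ℝ) :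
    |(thompsonLaw n p).real (Set.Iic z) - (bootstrapLaw n p).real (Set.Iic z)|
      ≤ armConstant p / √n := by
  have hn0 : (0 : ℝ) < n := by exact_mod_cast (by omega : 0 < n)
  have hC := armConstant_nonneg hp0 hp1
  have hprob := isProbabilityMeasure_thompsonLaw hn hp hp0 hp1
  obtain ⟨i, j, hnij, hnp, hlaw⟩ := exists_thompsonLaw_eq hn hp hp0 hp1
  rw [hlaw] at hprob ⊢
  set μ := betaMeasure ((i : ℝ) + 1) ((j : ℝ) + 1) with hμ
  rcases lt_or_ge z 0 with hz | hz
  · have h1 : μ.real (Set.Iic z) = 0 := by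
      rw [hμ, betaMeasure_real_apply i j measurableSet_Iic]
      have : Set.Iic z ∩ Set.Ioo 0 1 = ∅ := by
        ext x
        simp only [Set.mem_inter_iff, Set.mem_Iic, Set.mem_Ioo, Set.mem_empty_iff_false,
          iff_false, not_and]
        intro h h'
        linarith
      rw [this]
      simp
    have h2 : (bootstrapLaw n p).real (Set.Iic z) = 0 := by
      rw [bootstrapLaw, map_measureReal_apply (by fun_prop) measurableSet_Iic]
      have : (fun k : ℕ => (k : ℝ) / (n : ℝ)) ⁻¹' Set.Iic z = ∅ := by
        ext k
        simp only [Set.mem_preimage, Set.mem_Iic, Set.mem_empty_iff_false, iff_false, not_le]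
        exact hz.trans_le (by positivity)
      rw [this]
      simp
    rw [h1, h2, sub_zero, abs_zero]
    positivity
  rcases le_or_gt 1 z with hz1 | hz1
  · have hone : ∀ ν : Measure ℝ, IsProbabilityMeasure ν → ν.real (Set.Iic 1) = 1 →
        ν.real (Set.Iic z) = 1 := fun ν hν h => by
      refine le_antisymm measureReal_le_one ?_
      rw [← h]
      exact measureReal_mono (Set.Iic_subset_Iic.2 hz1)
    have h1 : μ.real (Set.Iic 1) = 1 := by
      rw [hμ, betaMeasure_real_Iic i j zero_le_one le_rfl,
        div_self (integral_betaWeight_pos i j).ne']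
    have h2 : (bootstrapLaw n p).real (Set.Iic 1) = 1 := by
      rw [bootstrapLaw_real_Iic (by omega) p zero_le_one, mul_one, Nat.floor_natCast,
        sum_binomialWeight]
    rw [hone _ hprob h1, hone _ inferInstance h2, sub_self, abs_zero]
    positivity
  -- The bootstrap distribution function has the same value F at z and at m/n, while the beta one
  -- varies over the cell by at most its mass.
  set m := ⌊n * z⌋₊ with hm
  have hmn : m < n := by
    rw [hm, Nat.floor_lt (by positivity)]
    nlinarith
  have hm1 : (m : ℝ) / n ≤ z := by
    rw [div_le_iff₀ hn0, mul_comm]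
    exact Nat.floor_le (by positivity)
  have hm2 : z ≤ ((m + 1 : ℕ) : ℝ) / n := by
    rw [le_div_iff₀ hn0, mul_comm]
    push_cast
    exact (Nat.lt_floor_add_one _).le
  have hm3 : ((m + 1 : ℕ) : ℝ) / n ≤ 1 := by
    rw [div_le_one hn0]
    exact_mod_cast hmn
  have hB := integral_betaWeight_pos i j
  rw [bootstrapLaw_real_Iic (by omega) p hz, ← hm]
  set F := ∑ k ∈ Finset.range (m + 1), binomialWeight n p k
  have hup : μ.real (Set.Iic z) ≤ μ.real (Set.Iic (((m + 1 : ℕ) : ℝ) / n)) :=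
    measureReal_mono (Set.Iic_subset_Iic.2 hm2)
  have hlow : μ.real (Set.Iic ((m : ℝ) / n)) ≤ μ.real (Set.Iic z) :=
    measureReal_mono (Set.Iic_subset_Iic.2 hm1)
  have hgrid : |μ.real (Set.Iic (((m + 1 : ℕ) : ℝ) / n)) - F|
      ≤ (1 + 7 * (2 / (p * (1 - p)))) / √n := by
    rw [hμ, betaMeasure_real_Iic i j (by positivity) hm3, div_sub' hB.ne', abs_div, abs_of_pos hB,
      div_le_iff₀ hB, mul_comm _ F]
    exact abs_integral_betaWeight_sub_le hnij hnp hp0 hp1 hmn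
  have hcell : μ.real (Set.Iic (((m + 1 : ℕ) : ℝ) / n)) - μ.real (Set.Iic ((m : ℝ) / n))
      ≤ 2 / (p * (1 - p)) / √n := by
    rw [hμ, betaMeasure_real_Iic i j (by positivity) hm3,
      betaMeasure_real_Iic i j (by positivity) (hm1.trans hz1.le), ← sub_div, div_le_iff₀ hB,
      intervalIntegral.integral_interval_sub_left
        ((continuous_betaWeight i j).intervalIntegrable _ _)
        ((continuous_betaWeight i j).intervalIntegrable _ _)]
    exact integral_cell_betaWeight_le hnij hnp hp0 hp1 hmn
  -- The 8 in the constant is 7 from the comparison on the grid plus 1 from the cell.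
  have e : armConstant p / √n
      = (1 + 7 * (2 / (p * (1 - p)))) / √n + 2 / (p * (1 - p)) / √n := by
    rw [← add_div, armConstant]
    ring_nf
  have hnn : 0 ≤ 2 / ((p : ℝ) * (1 - p)) / √n := by
    have : 0 < 1 - (p : ℝ) := by linarith
    positivity
  rw [e]
  rw [abs_le] at hgrid ⊢
  constructor <;> linarith [hgrid.1, hgrid.2]

/-- A bound on the Kolmogorov distance extends to all lower sets. -/
lemma abs_real_sub_le_of_isLowerSet {μ ν : Measure ℝ} [IsProbabilityMeasure μ]
    [IsProbabilityMeasure ν] {d : ℝ}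
    (h : ∀ z, |μ.real (Set.Iic z) - ν.real (Set.Iic z)| ≤ d) {S : Set ℝ} (hS : IsLowerSet S) :
    |μ.real S - ν.real S| ≤ d := by
  have hd : 0 ≤ d := (abs_nonneg _).trans (h 0)
  rcases S.eq_empty_or_nonempty with rfl | hne
  · simpa using hd
  by_cases hbdd : BddAbove S
  · have hlt : ∀ x < sSup S, x ∈ S := fun x hx => by
      obtain ⟨y, hy, hxy⟩ := exists_lt_of_lt_csSup hne hx
      exact hS hxy.le hy
    by_cases hc : sSup S ∈ S
    · have : S = Set.Iic (sSup S) :=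
        Set.Subset.antisymm (fun x hx => le_csSup hbdd hx) fun x hx => hS hx hc
      rw [this]
      exact h _
    · have hS' : S = Set.Iio (sSup S) := by
        refine Set.Subset.antisymm (fun x hx => ?_) fun x hx => hlt x hx
        exact lt_of_le_of_ne (le_csSup hbdd hx) fun hxe => hc (hxe ▸ hx)
      -- An open half-line is the increasing union of closed ones, and the bound passes to the
      -- limit.
      obtain ⟨u, hu, hult, hulim⟩ := exists_seq_strictMono_tendsto (sSup S)
      have hU : Set.Iio (sSup S) = ⋃ k, Set.Iic (u k) := by
        ext x
        simp only [Set.mem_Iio, Set.mem_iUnion, Set.mem_Iic]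
        refine ⟨fun hx => ?_, fun ⟨k, hk⟩ => hk.trans_lt (hult k)⟩
        obtain ⟨k, hk⟩ := (hulim.eventually (lt_mem_nhds hx)).exists
        exact ⟨k, hk.le⟩
      have hmono : Monotone fun k => Set.Iic (u k) := fun a b hab =>
        Set.Iic_subset_Iic.2 (hu.monotone hab)
      have hlim : ∀ ρ : Measure ℝ, IsProbabilityMeasure ρ → Filter.Tendsto
          (fun k => ρ.real (Set.Iic (u k))) Filter.atTop (nhds (ρ.real S)) := fun ρ _ => by
        rw [hS', hU]
        exact (ENNReal.tendsto_toReal (measure_ne_top _ _)).comp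
          (tendsto_measure_iUnion_atTop hmono)
      exact le_of_tendsto ((hlim μ inferInstance).sub (hlim ν inferInstance)).abs
        (Filter.Eventually.of_forall fun k => h (u k))
  · have : S = Set.univ := by
      refine Set.eq_univ_of_forall fun x => ?_
      obtain ⟨y, hy, hxy⟩ := not_bddAbove_iff.1 hbdd x
      exact hS hxy.le hy
    rw [this]
    simpa using hd

lemma abs_real_sub_le_of_isUpperSet {μ ν : Measure ℝ} [IsProbabilityMeasure μ]
    [IsProbabilityMeasure ν] {d : ℝ}
    (h : ∀ z, |μ.real (Set.Iic z) - ν.real (Set.Iic z)| ≤ d) {S : Set ℝ} (hS : IsUpperSet S) :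
    |μ.real S - ν.real S| ≤ d := by
  have h1 := abs_real_sub_le_of_isLowerSet h hS.compl
  have hm : MeasurableSet S := hS.ordConnected.measurableSet
  rw [probReal_compl_eq_one_sub hm, probReal_compl_eq_one_sub hm] at h1
  rw [abs_sub_comm]
  convert h1 using 2
  ring

end Laws

/-! ### Product measures: exchanging the factors. -/

section Product

/-- The measure of a set for a product measure, by integration of the measures of its sections in
one direction. -/
lemma pi_real_eq_integral_insertNth {K : ℕ} (μ : Fin (K + 1) → Measure ℝ)
    [∀ b, IsProbabilityMeasure (μ b)] (i : Fin (K + 1)) {S : Set (Fin (K + 1) → ℝ)}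
    (hS : MeasurableSet S) :
    (Integrable (fun y : Fin K → ℝ => (μ i).real {t | i.insertNth t y ∈ S})
      (Measure.pi fun j => μ (i.succAbove j))) ∧
    (Measure.pi μ).real S
      = ∫ y : Fin K → ℝ, (μ i).real {t | i.insertNth t y ∈ S}
        ∂(Measure.pi fun j => μ (i.succAbove j)) := by
  have hins : Measurable fun q : ℝ × (Fin K → ℝ) => (i.insertNth q.1 q.2 : Fin (K + 1) → ℝ) :=
    (MeasurableEquiv.piFinSuccAbove (fun _ => ℝ) i).symm.measurable
  have hE : MeasurableSet {q : ℝ × (Fin K → ℝ) | (i.insertNth q.1 q.2 : Fin (K + 1) → ℝ) ∈ S} :=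
    hins hS
  have hmeas : Measurable fun y : Fin K → ℝ => (μ i) {t | i.insertNth t y ∈ S} :=
    measurable_measure_prodMk_right hE
  refine ⟨Integrable.of_bound hmeas.ennreal_toReal.aestronglyMeasurable 1
    (Filter.Eventually.of_forall fun y => ?_), ?_⟩
  · rw [Real.norm_of_nonneg measureReal_nonneg]
    exact measureReal_le_one
  have h1 := (measurePreserving_piFinSuccAbove μ i).symm.measure_preimage hS.nullMeasurableSet
  rw [measureReal_def, ← h1]
  have h2 : (MeasurableEquiv.piFinSuccAbove (fun _ => ℝ) i).symm ⁻¹' S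
    = {q : ℝ × (Fin K → ℝ) | (i.insertNth q.1 q.2 : Fin (K + 1) → ℝ) ∈ S} := rfl
  rw [h2, Measure.prod_apply_symm hE]
  exact (integral_toReal hmeas.aemeasurable
    (Filter.Eventually.of_forall fun y => measure_lt_top _ _)).symm

/-- Changing one factor of a product measure changes the measure of a set by no more than the
largest change of the measure of its sections. -/
lemma abs_pi_real_sub_update_le {K : ℕ} (μ : Fin K → Measure ℝ) [∀ b, IsProbabilityMeasure (μ b)]
    (i : Fin K) (ρ : Measure ℝ) [IsProbabilityMeasure ρ] {S : Set (Fin K → ℝ)}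
    (hS : MeasurableSet S) {d : ℝ}
    (h : ∀ x : Fin K → ℝ, |(μ i).real {t | Function.update x i t ∈ S}
      - ρ.real {t | Function.update x i t ∈ S}| ≤ d) :
    |(Measure.pi μ).real S - (Measure.pi (Function.update μ i ρ)).real S| ≤ d := by
  obtain ⟨K, rfl⟩ : ∃ k, K = k + 1 := ⟨K - 1, by have := i.pos; omega⟩
  have hup : ∀ b, IsProbabilityMeasure (Function.update μ i ρ b) := fun b => by
    by_cases hb : b = i
    · subst hb; rw [Function.update_self]; infer_instance
    · rw [Function.update_of_ne hb]; infer_instance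
  obtain ⟨m1, e1⟩ := pi_real_eq_integral_insertNth μ i hS
  obtain ⟨m2, e2⟩ := pi_real_eq_integral_insertNth (Function.update μ i ρ) i hS
  have hsame : (fun j => Function.update μ i ρ (i.succAbove j)) = fun j => μ (i.succAbove j) := by
    funext j
    exact Function.update_of_ne (Fin.succAbove_ne i j) _ _
  rw [hsame] at e2 m2
  simp only [Function.update_self] at e2 m2
  rw [e1, e2, ← integral_sub m1 m2]
  have hb := norm_integral_le_of_norm_le_const (μ := Measure.pi fun j => μ (i.succAbove j))
    (f := fun y : Fin K → ℝ => (μ i).real {t | i.insertNth t y ∈ S}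
      - ρ.real {t | i.insertNth t y ∈ S}) (C := d)
    (Filter.Eventually.of_forall fun y => by
      have := h (i.insertNth 0 y)
      simp only [Fin.update_insertNth] at this
      exact this)
  simpa using hb

/-- Two coordinates coincide with probability zero if one of them has an atomless law. -/
lemma pi_setOf_eq_null {K : ℕ} (μ : Fin K → Measure ℝ) [∀ b, IsProbabilityMeasure (μ b)]
    {a b : Fin K} (hab : b ≠ a) [NullSingletonClass (μ b)] : Measure.pi μ {x | x b = x a} = 0 := by
  obtain ⟨K, rfl⟩ : ∃ k, K = k + 1 := ⟨K - 1, by have := a.pos; omega⟩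
  have hS : MeasurableSet {x : Fin (K + 1) → ℝ | x b = x a} :=
    measurableSet_eq_fun (measurable_pi_apply b) (measurable_pi_apply a)
  obtain ⟨c, rfl⟩ := Fin.exists_succAbove_eq hab.symm
  have h := (pi_real_eq_integral_insertNth μ b hS).2
  have hz : ∀ y : Fin K → ℝ, (μ b).real {t | (b.insertNth t y : Fin (K + 1) → ℝ) ∈
      {x : Fin (K + 1) → ℝ | x b = x (b.succAbove c)}} = 0 := by
    intro y
    have : {t : ℝ | (b.insertNth t y : Fin (K + 1) → ℝ) ∈
      {x : Fin (K + 1) → ℝ | x b = x (b.succAbove c)}} = {y c} := by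
      ext t
      simp
    rw [this, measureReal_def, measure_singleton, ENNReal.toReal_zero]
  simp only [hz, integral_zero] at h
  exact (measureReal_eq_zero_iff (measure_ne_top _ _)).1 h

/-- Two product measures are close on a set all of whose sections are lower or upper sets, if their
factors are close in Kolmogorov distance. -/
lemma abs_pi_real_sub_le {K : ℕ} (μ ν : Fin K → Measure ℝ) [∀ b, IsProbabilityMeasure (μ b)]
    [∀ b, IsProbabilityMeasure (ν b)] {d : Fin K → ℝ}
    (h : ∀ b z, |(μ b).real (Set.Iic z) - (ν b).real (Set.Iic z)| ≤ d b)
    {S : Set (Fin K → ℝ)} (hS : MeasurableSet S)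
    (hsec : ∀ b x, IsLowerSet {t | Function.update x b t ∈ S}
      ∨ IsUpperSet {t | Function.update x b t ∈ S}) :
    |(Measure.pi μ).real S - (Measure.pi ν).real S| ≤ ∑ b, d b := by
  -- Hybrid argument: the factors in t come from ν, the others from μ, and each insertion into t
  -- changes a single factor.
  have key : ∀ t : Finset (Fin K),
      |(Measure.pi μ).real S - (Measure.pi (t.piecewise ν μ)).real S| ≤ ∑ b ∈ t, d b := by
    intro t
    induction t using Finset.induction_on with
    | empty => simp
    | insert b t hb ih =>
      have hprob : ∀ c, IsProbabilityMeasure (t.piecewise ν μ c) := fun c => by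
        by_cases hc : c ∈ t
        · rw [Finset.piecewise_eq_of_mem _ _ _ hc]; infer_instance
        · rw [Finset.piecewise_eq_of_notMem _ _ _ hc]; infer_instance
      have hstep := abs_pi_real_sub_update_le (t.piecewise ν μ) b (ν b) hS (d := d b) (by
        intro x
        rw [Finset.piecewise_eq_of_notMem _ _ _ hb]
        rcases hsec b x with hl | hu
        · exact abs_real_sub_le_of_isLowerSet (h b) hl
        · exact abs_real_sub_le_of_isUpperSet (h b) hu)
      rw [Finset.piecewise_insert, Finset.sum_insert hb]
      have := abs_sub_le ((Measure.pi μ).real S) ((Measure.pi (t.piecewise ν μ)).real S)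
        ((Measure.pi (Function.update (t.piecewise ν μ) b (ν b))).real S)
      linarith
  simpa using key Finset.univ

end Product

/-! ### The argmax events, ties, and the conclusion. -/

section Argmax

variable {K : ℕ}

lemma measurableSet_forall_le (a : Fin K) : MeasurableSet {x : Fin K → ℝ | ∀ b, x b ≤ x a} := by
  rw [Set.ofPred_forall]
  exact MeasurableSet.iInter fun b =>
    measurableSet_le (measurable_pi_apply b) (measurable_pi_apply a)

lemma measurableSet_forall_lt (a : Fin K) :
    MeasurableSet {x : Fin K → ℝ | ∀ b, b ≠ a → x b < x a} := by
  rw [Set.ofPred_forall]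
  refine MeasurableSet.iInter fun b => ?_
  by_cases hb : b = a
  · simp [hb]
  · simpa [hb] using measurableSet_lt (measurable_pi_apply b) (measurable_pi_apply a)

/-- Raising coordinate a can only help arm a, and raising any other can only hurt it: the sections
are upper sets for b = a and lower sets otherwise. -/
lemma sections_forall_le (a b : Fin K) (x : Fin K → ℝ) :
    IsLowerSet {t | Function.update x b t ∈ {x : Fin K → ℝ | ∀ b, x b ≤ x a}}
      ∨ IsUpperSet {t | Function.update x b t ∈ {x : Fin K → ℝ | ∀ b, x b ≤ x a}} := by
  by_cases hb : b = a
  · subst hb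
    refine Or.inr fun t u htu ht c => ?_
    have := ht c
    by_cases hc : c = b
    · subst hc; exact le_rfl
    · rw [Function.update_self, Function.update_of_ne hc] at this ⊢
      exact this.trans htu
  · refine Or.inl fun t u hut ht c => ?_
    have := ht c
    rw [Function.update_of_ne (Ne.symm hb)] at this ⊢
    by_cases hc : c = b
    · subst hc
      rw [Function.update_self] at this ⊢
      exact hut.trans this
    · rwa [Function.update_of_ne hc] at this ⊢

lemma sections_forall_lt (a b : Fin K) (x : Fin K → ℝ) :
    IsLowerSet {t | Function.update x b t ∈ {x : Fin K → ℝ | ∀ b, b ≠ a → x b < x a}}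
      ∨ IsUpperSet {t | Function.update x b t ∈ {x : Fin K → ℝ | ∀ b, b ≠ a → x b < x a}} := by
  by_cases hb : b = a
  · subst hb
    refine Or.inr fun t u htu ht c hc => ?_
    have := ht c hc
    rw [Function.update_self, Function.update_of_ne hc] at this ⊢
    exact this.trans_le htu
  · refine Or.inl fun t u hut ht c hca => ?_
    have := ht c hca
    rw [Function.update_of_ne (Ne.symm hb)] at this ⊢
    by_cases hc : c = b
    · subst hc
      rw [Function.update_self] at this ⊢
      exact hut.trans_lt this
    · rwa [Function.update_of_ne hc] at this ⊢

/-- Whatever the tie-breaking rule, the probability of choosing an arm lies between the probability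
that it is the only best arm and the probability that it is one of the best arms. -/
lemma IsArgmaxAction.bounds {Ω : Type*} [MeasurableSpace Ω] {P : Measure Ω}
    [IsProbabilityMeasure P] {law : Fin K → Measure ℝ} {A : Ω → Fin K}
    (h : IsArgmaxAction P law A) (a : Fin K) :
    (Measure.pi law).real {x | ∀ b, b ≠ a → x b < x a} ≤ P.real {ω | A ω = a} ∧
      P.real {ω | A ω = a} ≤ (Measure.pi law).real {x | ∀ b, x b ≤ x a} := by
  obtain ⟨θ, hlaw, hind, hmax⟩ := h.exists_draws
  have hmeas : AEMeasurable (fun ω b => θ b ω) P :=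
    aemeasurable_pi_lambda _ fun b => (hlaw b).aemeasurable
  have hmap : P.map (fun ω b => θ b ω) = Measure.pi law := by
    rw [(iIndepFun_iff_map_fun_eq_pi_map fun b => (hlaw b).aemeasurable).1 hind]
    congr 1
    funext b
    exact (hlaw b).map_eq
  rw [← hmap, map_measureReal_apply_of_aemeasurable hmeas (measurableSet_forall_lt a),
    map_measureReal_apply_of_aemeasurable hmeas (measurableSet_forall_le a)]
  constructor
  · refine ENNReal.toReal_mono (measure_ne_top _ _) (measure_mono_ae ?_)
    filter_upwards [hmax] with ω hω hlt
    by_contra hne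
    exact absurd (hlt (A ω) hne) (not_lt.2 (hω a))
  · refine ENNReal.toReal_mono (measure_ne_top _ _) (measure_mono_ae ?_)
    filter_upwards [hmax] with ω hω hA b
    have hA' : A ω = a := hA
    rw [← hA']
    exact hω b

/-- With atomless laws, the best arm is unique almost surely. -/
lemma pi_real_forall_le_eq (law : Fin K → Measure ℝ) [∀ b, IsProbabilityMeasure (law b)]
    [∀ b, NullSingletonClass (law b)] (a : Fin K) :
    (Measure.pi law).real {x | ∀ b, x b ≤ x a}
      = (Measure.pi law).real {x | ∀ b, b ≠ a → x b < x a} := by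
  refine measureReal_congr ?_
  have hne : ∀ᵐ x ∂(Measure.pi law), ∀ b, b ≠ a → x b ≠ x a := by
    refine ae_all_iff.2 fun b => ?_
    by_cases hb : b = a
    · simp [hb]
    · have h : ∀ᵐ x ∂(Measure.pi law), x b ≠ x a := by
        rw [ae_iff]
        simpa using pi_setOf_eq_null law hb
      exact h.mono fun x hx _ => hx
  filter_upwards [hne] with x hx
  refine propext ⟨fun h b hb => lt_of_le_of_ne (h b) (hx b hb), fun h b => ?_⟩
  by_cases hb : b = a
  · rw [hb]
  · exact (h b hb).le

instance nullSingletonClass_thompsonLaw (n : ℕ) (p : unitInterval) : NullSingletonClass (thompsonLaw n p) :=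
  ⟨fun x => withDensity_absolutelyContinuous _ _ (measure_singleton x)⟩

end Argmax

theorem theorem1 (K : ℕ) :
    ∃ C : Fin K → (Fin K → unitInterval) → ℝ,
      ∀ (n s : Fin K → ℕ) (p : Fin K → unitInterval),
        (∀ b, 2 ≤ n b) →
        -- `p b` is the proportion of successes: `s b` successes among `n b` observations
        (∀ b, (p b : ℝ) = (s b : ℝ) / (n b : ℝ)) →
        (∀ b, 0 < (p b : ℝ) ∧ (p b : ℝ) < 1) →
        ∀ {Ω Ω' : Type*} [MeasurableSpace Ω] [MeasurableSpace Ω']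
          (P : Measure Ω) (P' : Measure Ω') [IsProbabilityMeasure P] [IsProbabilityMeasure P']
          (aTS : Ω → Fin K) (aB : Ω' → Fin K),
          IsArgmaxAction P (fun b => thompsonLaw (n b) (p b)) aTS →
          IsArgmaxAction P' (fun b => bootstrapLaw (n b) (p b)) aB →
          ∀ a : Fin K,
            |P.real {ω | aTS ω = a} - P'.real {ω | aB ω = a}|
              ≤ C a p * ∑ b, 1 / Real.sqrt (n b : ℝ) := by
  refine ⟨fun _ p => ∑ b, armConstant (p b), ?_⟩
  intro n s p hn hp hp01 Ω Ω' _ _ P P' _ _ aTS aB hTS hB a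
  have hprob : ∀ b, IsProbabilityMeasure (thompsonLaw (n b) (p b)) := fun b =>
    isProbabilityMeasure_thompsonLaw (hn b) (hp b) (hp01 b).1 (hp01 b).2
  have hclose : ∀ b z, |(thompsonLaw (n b) (p b)).real (Set.Iic z)
      - (bootstrapLaw (n b) (p b)).real (Set.Iic z)| ≤ armConstant (p b) / √(n b) := fun b z =>
    abs_thompsonLaw_real_Iic_sub_le (hn b) (hp b) (hp01 b).1 (hp01 b).2 z
  have hle := abs_pi_real_sub_le (fun b => thompsonLaw (n b) (p b))
    (fun b => bootstrapLaw (n b) (p b)) hclose (measurableSet_forall_le a) (sections_forall_le a)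
  have hlt := abs_pi_real_sub_le (fun b => thompsonLaw (n b) (p b))
    (fun b => bootstrapLaw (n b) (p b)) hclose (measurableSet_forall_lt a) (sections_forall_lt a)
  -- For Thompson sampling the sandwich collapses to one value. The two bootstrap bounds may differ
  -- because of ties, but `hlt` and `hle` place each of them near that value.
  have heq := pi_real_forall_le_eq (fun b => thompsonLaw (n b) (p b)) a
  obtain ⟨t1, t2⟩ := hTS.bounds a
  obtain ⟨b1, b2⟩ := hB.bounds a
  have hsum : ∑ b, armConstant (p b) / √(n b)
      ≤ (∑ b, armConstant (p b)) * ∑ b, 1 / √(n b : ℝ) := by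
    rw [Finset.sum_mul]
    refine Finset.sum_le_sum fun b _ => ?_
    rw [div_eq_mul_one_div]
    refine mul_le_mul_of_nonneg_left ?_ (armConstant_nonneg (hp01 b).1 (hp01 b).2)
    exact Finset.single_le_sum (f := fun b => 1 / √(n b : ℝ)) (fun c _ => by positivity)
      (Finset.mem_univ b)
  refine le_trans ?_ hsum
  rw [abs_le] at hle hlt ⊢
  constructor <;> linarith [hle.1, hle.2, hlt.1, hlt.2]
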